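/- **Setting.** Let $H$ be a separable complex Hilbert space of dimension $\aleph_0$ with orthonormal basis $(e_n)_{n\in\mathbb N}$, and let $e_{i,j}\in B(H)$, $e_{i,j}\xi=\langle e_j,\xi\rangle e_i$, be the corresponding matrix units. For a set $\Omega$ let $F(\Omega,B(H))$ be the $*$-algebra of all maps $\Omega\to B(H)$ with pointwise operations, let $F(\Omega,B_{sk}(H))=\{a\in F(\Omega,B(H)):a^*=-a\}$ be the real Lie algebra of all maps from $\Omega$ to the skew-adjoint operators, with $[a,b]=ab-ba$, and let $\hat e_{i,j}\in F(\Omega,B(H))$ be the constant map with value $e_{i,j}$. For $a\in F(\Omega,B_{sk}(H))$ put $R_a(x)=[a,x]$. Let $\mathcal K\subset F(\Omega,B_{sk}(H))$ be a real subspace. A map $\Delta:\mathcal K\to\mathcal K$ (not assumed additive) is called *2-local spatial, implemented by elements of $F(\Omega,B_{sk}(H))$*, if for all $x,y\in\mathcal K$ there is $a\in F(\Omega,B_{sk}(H))$, depending on $x$ and $y$, with $\Delta(x)=[a,x]$ and $\Delta(y)=[a,y]$. **Theorem.** Let $\Omega$ be a hyperstonean compact space, i.e. a compact Hausdorff extremally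 disconnected space in which every nonempty open set has positive measure for some normal measure (finite, regular, Borel, and preserving suprema of bounded increasing nets in $C(\Omega,\mathbb R)$). 1. Let $\mathcal N$ be a unital $*$-subalgebra of $F(\Omega,B(H))$ that contains all $\hat e_{i,j}$ and is a von Neumann algebra (i.e. is $*$-isomorphic to a $C^*$-algebra with a Banach space predual) of type I with center $*$-isomorphic to $C(\Omega)$. Let $\mathcal K=\{a\in\mathcal N:a^*=-a\}$, a Lie subalgebra of $F(\Omega,B_{sk}(H))$. Then every 2-local spatial map $\Delta$ on $\mathcal K$ implemented by elements of $F(\Omega,B_{sk}(H))$ is a spatial derivation: it is a derivation of the Lie algebra $\mathcal K$ and there is $a\in F(\Omega,B_{sk}(H))$ with $\Delta(x)=R_a(x)$ for all $x\in\mathcal K$. 2. The same holds when $\mathcal N$ is the standard function model of the type I von Neumann algebra $C(\Omega)\,\overline{\otimes}\,B(H)$, namely the set of all norm-bounded maps $a:\Omega\to B(H)$ whose matrix entries $t\mapsto\langle e_i,a(t)e_j\rangle$ are all continuous (its product agrees with the pointwise product only off a meagre set, and $\mathcal K=\{a\in\mathcal N:a^*=-a\}$ is regarded as a real subspace of $F(\Omega,B_{sk}(H))$):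 for every 2-local spatial map $\Delta:\mathcal K\to\mathcal K$ implemented by elements of $F(\Omega,B_{sk}(H))$ there is $a\in F(\Omega,B_{sk}(H))$ with $\Delta(x)=R_a(x)$ for all $x\in\mathcal K$, where $R_a$ is computed pointwise. -/

import Mathlib

noncomputable section

namespace SpatialDerivations

open MeasureTheory

/-! ### Spatial and 2-local spatial derivations -/

section Spatial

variable {A : Type*} [LieRing A]

/-- `D x = [a, x]` for all `x ∈ K` : the map `D` on `K` is implemented by the element `a` of the
ambient Lie algebra. -/
def IsImplementedBy {S : Type*} [SetLike S A] (K : S) (D : K → K) (a : A) : Prop :=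
  ∀ x : K, ((D x : K) : A) = ⁅a, (x : A)⁆

/-- `Δ` is a (not necessarily additive) map on `K` such that for every two elements `x, y ∈ K`
there is an element `a` of the ambient Lie algebra, depending on `x` and `y`, with
`Δ x = [a, x]` and `Δ y = [a, y]`. -/
def IsTwoLocalSpatial {S : Type*} [SetLike S A] (K : S) (Δ : K → K) : Prop :=
  ∀ x y : K, ∃ a : A,
    ((Δ x : K) : A) = ⁅a, (x : A)⁆ ∧ ((Δ y : K) : A) = ⁅a, (y : A)⁆

/-- `Δ` is a Lie derivation of the Lie subalgebra `K` that is implemented by an element of the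
ambient Lie algebra. -/
def IsSpatialDerivation [LieAlgebra ℝ A] (K : LieSubalgebra ℝ A) (Δ : K → K) : Prop :=
  ∃ D : LieDerivation ℝ K K, (∀ x, Δ x = D x) ∧ ∃ a : A, IsImplementedBy K D a

end Spatial

/-! ### Hyperstonean spaces -/

/-- A finite regular Borel measure on a compact Hausdorff space is *normal* if integration against
it preserves suprema of bounded increasing nets in `C(Ω, ℝ)`. -/
structure IsNormalMeasure {Ω : Type*} [TopologicalSpace Ω] [MeasurableSpace Ω]
    (μ : Measure Ω) : Prop where
  finite : IsFiniteMeasure μ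
  regular : μ.Regular
  isLUB_integral : ∀ (D : Set C(Ω, ℝ)) (g : C(Ω, ℝ)), D.Nonempty → DirectedOn (· ≤ ·) D →
    IsLUB D g → IsLUB ((fun f : C(Ω, ℝ) => ∫ t, f t ∂μ) '' D) (∫ t, g t ∂μ)

/-- A hyperstonean compact: a compact Hausdorff extremally disconnected space with sufficiently
many normal measures (every nonempty open set is charged by one). -/
structure IsHyperstonean (Ω : Type*) [TopologicalSpace Ω] : Prop where
  compact : CompactSpace Ω
  t2 : T2Space Ω
  extremallyDisconnected : ExtremallyDisconnected Ω
  exists_normal : ∀ U : Set Ω, IsOpen U → U.Nonempty →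
    ∃ μ : @Measure Ω (borel Ω), @IsNormalMeasure Ω _ (borel Ω) μ ∧ μ U ≠ 0

/-! ### Von Neumann algebras of type I -/

/-- A complex `*`-algebra is a von Neumann algebra if it is `*`-isomorphic to a C⋆-algebra with a
Banach space predual. -/
def IsVonNeumannAlgebra.{u} (N : Type u) [Ring N] [StarRing N] [Algebra ℂ N] : Prop :=
  ∃ (M : Type u) (_ : CStarAlgebra M) (_ : WStarAlgebra M), Nonempty (N ≃⋆ₐ[ℂ] M)

/-- An abelian projection: a projection `p` whose corner `pNp` is commutative. -/
def IsAbelianProjection {N : Type*} [Ring N] [StarRing N] (p : N) : Prop :=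
  IsStarProjection p ∧ ∀ x y : N, (p * x * p) * (p * y * p) = (p * y * p) * (p * x * p)

/-- Type I: every nonzero central projection majorizes a nonzero abelian projection. -/
def IsTypeI (N : Type*) [Ring N] [StarRing N] : Prop :=
  ∀ z : N, IsStarProjection z → z ∈ Set.center N → z ≠ 0 →
    ∃ p : N, IsAbelianProjection p ∧ p ≠ 0 ∧ z * p = p

/-! ### Operator-valued maps -/

variable (Ω : Type*) (H : Type*) [NormedAddCommGroup H] [InnerProductSpace ℂ H] [CompleteSpace H]

/-- `F(Ω, B(H))`: all maps from `Ω` to `B(H)`, with pointwise operations. -/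
abbrev OpMaps : Type _ := Ω → (H →L[ℂ] H)

/-- The commutator bracket `[a, b] = ab - ba` on `F(Ω, B(H))`. -/
instance instLieRingOpMaps : LieRing (OpMaps Ω H) := LieRing.ofAssociativeRing

/-- `F(Ω, B_sk(H))`: all maps from `Ω` to the skew-adjoint bounded operators on `H`, a real Lie
algebra under the pointwise bracket `[a, b](t) = a(t) b(t) - b(t) a(t)`. -/
def SkewMaps : LieSubalgebra ℝ (OpMaps Ω H) where
  carrier := {a | star a = -a}
  add_mem' {a b} ha hb := by
    simp only [Set.mem_ofPred_eq] at ha hb ⊢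
    rw [star_add, ha, hb, neg_add]
  zero_mem' := by simp
  smul_mem' r a ha := by
    simp only [Set.mem_ofPred_eq] at ha ⊢
    rw [star_smul, ha, star_trivial, smul_neg]
  lie_mem' {a b} ha hb := by
    change star a = -a at ha
    change star b = -b at hb
    change star (a * b - b * a) = -(a * b - b * a)
    rw [star_sub, star_mul, star_mul, ha, hb]
    simp

variable {H}

/-- The constant map `ê_{i,j} : Ω → B(H)`, whose value is the matrix unit
`ξ ↦ ⟪e_j, ξ⟫ e_i` of the orthonormal basis `(e_n)`. -/
def matrixUnit (e : HilbertBasis ℕ ℂ H) (i j : ℕ) : OpMaps Ω H :=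
  fun _ => InnerProductSpace.rankOne ℂ (e i) (e j)

variable {Ω}

/-- The skew-adjoint part `{a ∈ N : a* = -a}` of a `*`-subalgebra of `F(Ω, B(H))`, a Lie subalgebra of
`F(Ω, B_sk(H))`. -/
def skewPart (N : StarSubalgebra ℂ (OpMaps Ω H)) : LieSubalgebra ℝ (SkewMaps Ω H) where
  carrier := {a | (a : OpMaps Ω H) ∈ N}
  add_mem' ha hb := add_mem (S := StarSubalgebra ℂ (OpMaps Ω H)) ha hb
  zero_mem' := zero_mem N
  smul_mem' r a ha := by
    have h : ((r : ℂ) • (a : OpMaps Ω H)) ∈ N := N.smul_mem ha _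
    exact h
  lie_mem' {a b} ha hb := by
    change (a : OpMaps Ω H) * (b : OpMaps Ω H) - (b : OpMaps Ω H) * (a : OpMaps Ω H) ∈ N
    exact sub_mem (mul_mem ha hb) (mul_mem hb ha)

/-- The standard function model of the von Neumann tensor product of `C(Ω)` and `B(H)`:
the norm-bounded maps `a : Ω → B(H)` all of whose matrix entries `t ↦ ⟪e_i, a(t) e_j⟫` are
continuous. -/
def IsContinuousModel [TopologicalSpace Ω] (e : HilbertBasis ℕ ℂ H) (a : OpMaps Ω H) : Prop :=
  (∃ C : ℝ, ∀ t, ‖a t‖ ≤ C) ∧ ∀ i j : ℕ, Continuous fun t => inner ℂ (e i) (a t (e j))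

/-- The skew-adjoint part of the standard function model, a real subspace of `F(Ω, B_sk(H))`. -/
def continuousModelSkew [TopologicalSpace Ω] (e : HilbertBasis ℕ ℂ H) :
    Submodule ℝ (SkewMaps Ω H) where
  carrier := {a | IsContinuousModel e (a : OpMaps Ω H)}
  add_mem' {a b} ha hb := by
    obtain ⟨⟨C, hC⟩, ha⟩ := ha
    obtain ⟨⟨C', hC'⟩, hb⟩ := hb
    refine ⟨⟨C + C', fun t => (norm_add_le _ _).trans (add_le_add (hC t) (hC' t))⟩,
      fun i j => ?_⟩
    refine ((ha i j).add (hb i j)).congr fun t => ?_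
    rw [Pi.add_apply, ← inner_add_right]
    rfl
  zero_mem' := ⟨⟨0, fun t => by simp⟩, fun i j => by simpa using continuous_const⟩
  smul_mem' r a ha := by
    obtain ⟨⟨C, hC⟩, ha⟩ := ha
    refine ⟨⟨|r| * C, fun t => ?_⟩, fun i j => ?_⟩
    · have h : ‖r • (a : OpMaps Ω H) t‖ ≤ |r| * C := by
        rw [norm_smul, Real.norm_eq_abs]
        exact mul_le_mul_of_nonneg_left (hC t) (abs_nonneg r)
      exact h
    · have h : Continuous fun t => (r : ℂ) * inner ℂ (e i) ((a : OpMaps Ω H) t (e j)) :=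
        continuous_const.mul (ha i j)
      refine h.congr fun t => ?_
      rw [← inner_smul_right]
      rfl

end SpatialDerivations

end

namespace SpatialDerivations

open InnerProductSpace ComplexConjugate

/-! ### Commutators with a fixed skew-adjoint operator, at one point of `Ω` -/

section Operators

variable {H : Type*} [NormedAddCommGroup H] [InnerProductSpace ℂ H]

/-! Two constant test maps determine the implementing element: `x₀ = iD` with `D` diagonal with
distinct entries, and `y₀ = i|v⟩⟨v|` with `v` generic. Let `a` implement `Δ` at both. At each point
`t`, the defect `δ = Δ - [a, ·]` is still locally a commutator with a skew-adjoint operator and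
kills `x₀` and `y₀`; `eq_zero_of_twoLocal_commutator` shows that it is zero.

For `z = i|u⟩⟨u|`, pairing with `x₀` gives `δ z = [c, z]` with `c` diagonal. Pairing with `y₀` makes
the state of `v` vanish on `δ z`; for `u = eᵢ + w eⱼ` with `w = 1` or `w = i` this equates the two
eigenvalues of `c`, so `δ z = 0`. Pairing any `x` with such a `z` gives `⟪u, δ x u⟫ = 0`, and
polarization finishes.

The domain must contain `x₀`, `y₀` and these `z` as constant maps. For a von Neumann algebra,
`tsum_const_rankOne_mem` provides the infinite series among them. -/

theorem commutator_apply (c X : H →L[ℂ] H) (u : H) :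
    (c * X - X * c) u = c (X u) - X (c u) := rfl

/-- An operator is zero if its quadratic form vanishes on the vectors `eᵢ`, `eᵢ + eⱼ` and
`eᵢ + i eⱼ`. -/
theorem eq_zero_of_quadratic_form_basis (e : HilbertBasis ℕ ℂ H) {X : H →L[ℂ] H}
    (h0 : ∀ i, inner ℂ (e i) (X (e i)) = (0 : ℂ))
    (h1 : ∀ i j, i ≠ j → inner ℂ (e i + e j) (X (e i + e j)) = (0 : ℂ))
    (h2 : ∀ i j, i ≠ j →
      inner ℂ (e i + Complex.I • e j) (X (e i + Complex.I • e j)) = (0 : ℂ)) : X = 0 := by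
  have key : ∀ i j, inner ℂ (e i) (X (e j)) = (0 : ℂ) := by
    intro i j
    rcases eq_or_ne i j with rfl | hij
    · exact h0 i
    have a1 := h1 i j hij
    have a2 := h2 i j hij
    simp only [map_add, map_smul, inner_add_left, inner_add_right, inner_smul_left,
      inner_smul_right, h0, Complex.conj_I] at a1 a2
    linear_combination (1 / 2 : ℂ) * a1 - (Complex.I / 2) * a2 +
      (inner ℂ (e i) (X (e j)) / 2 - inner ℂ (e j) (X (e i)) / 2) * Complex.I_sq
  have h3 : ∀ j, X (e j) = 0 := by
    intro j
    apply e.repr.injective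
    ext i
    rw [e.repr_apply_apply, key, map_zero]
    rfl
  refine ContinuousLinearMap.ext_on (s := Set.range e) ?_ ?_
  · rw [dense_iff_closure_eq, ← Submodule.topologicalClosure_coe, e.dense_span]
    rfl
  · rintro _ ⟨j, rfl⟩
    simp [h3]

variable [CompleteSpace H]

theorem inner_apply_eq_neg_of_star_eq_neg {c : H →L[ℂ] H} (hc : star c = -c) (x y : H) :
    inner ℂ x (c y) = -inner ℂ (c x) y := by
  rw [← ContinuousLinearMap.adjoint_inner_left, ← ContinuousLinearMap.star_eq_adjoint, hc]
  simp

/-- An eigenvalue of a skew-adjoint operator is purely imaginary. -/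
theorem conj_eigenvalue_of_star_eq_neg {c : H →L[ℂ] H} (hc : star c = -c) {u : H} (hu : u ≠ 0)
    {l : ℂ} (hl : c u = l • u) : conj l = -l := by
  have := inner_apply_eq_neg_of_star_eq_neg hc u u
  rw [hl, inner_smul_left, inner_smul_right, ← neg_mul, eq_comm] at this
  exact neg_eq_iff_eq_neg.1 (mul_right_cancel₀ (inner_self_ne_zero.2 hu) this)

/-- If a skew-adjoint operator commutes with the rank-one operator of `u`, then the vector state
of `u` vanishes on every commutator with it. -/
theorem inner_commutator_eq_zero {c : H →L[ℂ] H} (hc : star c = -c) (u : H)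
    (h : c * (Complex.I • rankOne ℂ u u) - (Complex.I • rankOne ℂ u u) * c = 0)
    (X : H →L[ℂ] H) : inner ℂ u ((c * X - X * c) u) = 0 := by
  rcases eq_or_ne u 0 with rfl | hu
  · simp
  have huu : inner ℂ u u ≠ (0 : ℂ) := inner_self_ne_zero.2 hu
  -- Evaluating the commutation relation at `u` makes `u` an eigenvector of `c`.
  have h1 : inner ℂ u u • c u = inner ℂ u (c u) • u := by
    have := congrArg (fun T : H →L[ℂ] H => T u) h
    simp only [commutator_apply, smul_apply, rankOne_apply, map_smul, zero_apply,
      sub_eq_zero] at this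
    exact smul_right_injective H Complex.I_ne_zero this
  obtain ⟨l, hl⟩ : ∃ l : ℂ, c u = l • u :=
    ⟨(inner ℂ u u)⁻¹ * inner ℂ u (c u), by rw [mul_smul, ← h1, inv_smul_smul₀ huu]⟩
  have h3 := inner_apply_eq_neg_of_star_eq_neg hc u (X u)
  rw [commutator_apply, inner_sub_right, h3, hl, map_smul, inner_smul_left, inner_smul_right]
  linear_combination (-inner ℂ u (X u)) * conj_eigenvalue_of_star_eq_neg hc hu hl

/-- A skew-adjoint operator commutes with the rank-one operators of its eigenvectors. -/
theorem commutator_rankOne_eq_zero {c : H →L[ℂ] H} (hc : star c = -c) {u : H} {l : ℂ}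
    (hl : c u = l • u) :
    c * (Complex.I • rankOne ℂ u u) - (Complex.I • rankOne ℂ u u) * c = 0 := by
  rcases eq_or_ne u 0 with rfl | hu
  · simp
  ext x
  have h := inner_apply_eq_neg_of_star_eq_neg hc u x
  rw [hl, inner_smul_left, conj_eigenvalue_of_star_eq_neg hc hu hl] at h
  simp only [commutator_apply, smul_apply, rankOne_apply, map_smul, zero_apply, h, hl]
  module

/-- An operator commuting with a skew-adjoint diagonal operator with simple spectrum is
diagonal. -/
theorem exists_eigenvalue_of_commute_diagonal (e : HilbertBasis ℕ ℂ H) {D c : H →L[ℂ] H}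
    (hD : star D = -D) {m : ℕ → ℝ} (hm : Function.Injective m)
    (hDe : ∀ n, D (e n) = (Complex.I * m n) • e n) (h : c * D - D * c = 0) (n : ℕ) :
    ∃ l : ℂ, c (e n) = l • e n := by
  refine ⟨inner ℂ (e n) (c (e n)), ?_⟩
  have key : ∀ k, k ≠ n → inner ℂ (e k) (c (e n)) = (0 : ℂ) := by
    intro k hk
    have h1 := congrArg (fun T : H →L[ℂ] H => inner ℂ (e k) (T (e n))) h
    simp only [commutator_apply, inner_sub_right, zero_apply, inner_zero_right] at h1
    rw [inner_apply_eq_neg_of_star_eq_neg hD, hDe, hDe, map_smul, inner_smul_left,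
      inner_smul_right] at h1
    simp only [map_mul, Complex.conj_I, Complex.conj_ofReal] at h1
    have h2 : Complex.I * ((m n : ℂ) - m k) * inner ℂ (e k) (c (e n)) = 0 := by
      linear_combination h1
    refine (mul_eq_zero.1 h2).resolve_left (mul_ne_zero Complex.I_ne_zero ?_)
    rw [sub_ne_zero]
    exact fun h => hk (hm (Complex.ofReal_injective h)).symm
  apply e.repr.injective
  ext k
  rw [e.repr_apply_apply, e.repr_apply_apply, inner_smul_right]
  rcases eq_or_ne k n with rfl | hk
  · rw [inner_self_eq_norm_sq_to_K, e.orthonormal.1]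
    simp
  · rw [key k hk, e.orthonormal.2 hk, mul_zero]

/-- A map which is locally given by commutators with skew-adjoint operators vanishes, once it
vanishes at a diagonal operator with simple spectrum and at the rank-one operator of a
sufficiently generic vector. -/
theorem eq_zero_of_twoLocal_commutator (e : HilbertBasis ℕ ℂ H) {X : Type*}
    (ev δ : X → H →L[ℂ] H)
    (hδ : ∀ x y, ∃ c : H →L[ℂ] H, star c = -c ∧ δ x = c * ev x - ev x * c ∧
      δ y = c * ev y - ev y * c)
    {x₀ y₀ : X} (hx₀ : δ x₀ = 0) (hy₀ : δ y₀ = 0)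
    (hD : star (ev x₀) = -ev x₀) {m : ℕ → ℝ} (hm : Function.Injective m)
    (hDe : ∀ n, ev x₀ (e n) = (Complex.I * m n) • e n)
    {v : H} (hv : ev y₀ = Complex.I • rankOne ℂ v v)
    (hre : ∀ i j, i ≠ j → (inner ℂ v (e i) * inner ℂ (e j) v : ℂ).re ≠ 0)
    (him : ∀ i j, i ≠ j → (inner ℂ v (e i) * inner ℂ (e j) v : ℂ).im ≠ 0)
    (hspan : ∀ u ∈ Submodule.span ℂ (Set.range e), ∃ x, ev x = Complex.I • rankOne ℂ u u)
    (x : X) : δ x = 0 := by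
  have vanish : ∀ {u : H} {z : X}, ev z = Complex.I • rankOne ℂ u u → δ z = 0 →
      ∀ x, inner ℂ u (δ x u) = (0 : ℂ) := by
    intro u z hz hz0 x
    obtain ⟨c, hc, h1, h2⟩ := hδ x z
    rw [hz0, hz] at h2
    rw [h1]
    exact inner_commutator_eq_zero hc u h2.symm _
  have diag : ∀ z, ∃ l : ℕ → ℂ, ∃ c : H →L[ℂ] H, star c = -c ∧ (∀ n, c (e n) = l n • e n) ∧
      δ z = c * ev z - ev z * c := by
    intro z
    obtain ⟨c, hc, h1, h2⟩ := hδ z x₀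
    rw [hx₀] at h2
    choose l hl using exists_eigenvalue_of_commute_diagonal e hD hm hDe h2.symm
    exact ⟨l, c, hc, hl, h1⟩
  have comm : ∀ (c : H →L[ℂ] H), star c = -c → ∀ u w : H,
      inner ℂ w ((c * (Complex.I • rankOne ℂ u u) - (Complex.I • rankOne ℂ u u) * c) w) =
        Complex.I * (inner ℂ u w * inner ℂ w (c u) + inner ℂ (c u) w * inner ℂ w u) := by
    intro c hc u w
    simp only [commutator_apply, smul_apply, rankOne_apply, map_smul, inner_sub_right,
      inner_smul_right]
    rw [inner_apply_eq_neg_of_star_eq_neg hc u w]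
    ring
  have mem : ∀ i, e i ∈ Submodule.span ℂ (Set.range e) := fun i =>
    Submodule.subset_span ⟨i, rfl⟩
  have single : ∀ i, inner ℂ (e i) (δ x (e i)) = (0 : ℂ) := by
    intro i
    obtain ⟨z, hz⟩ := hspan (e i) (mem i)
    refine vanish hz ?_ x
    obtain ⟨l, c, hc, hl, h1⟩ := diag z
    rw [h1, hz]
    exact commutator_rankOne_eq_zero hc (hl i)
  have pair : ∀ i j (w : ℂ), i ≠ j →
      (w * (inner ℂ v (e j) * inner ℂ (e i) v)).im ≠ 0 →
      inner ℂ (e i + w • e j) (δ x (e i + w • e j)) = (0 : ℂ) := by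
    intro i j w hij hw
    obtain ⟨z, hz⟩ := hspan (e i + w • e j)
      (Submodule.add_mem _ (mem i) (Submodule.smul_mem _ _ (mem j)))
    refine vanish hz ?_ x
    obtain ⟨l, c, hc, hl, h1⟩ := diag z
    have h2 := vanish hv hy₀ z
    have hconj : ∀ n, conj (l n) = -l n := fun n =>
      conj_eigenvalue_of_star_eq_neg hc (e.orthonormal.ne_zero n) (hl n)
    rw [h1, hz, comm c hc] at h2
    simp only [map_add, map_smul, hl, inner_add_left, inner_add_right, inner_smul_left,
      inner_smul_right, hconj] at h2
    set s := w * (inner ℂ v (e j) * inner ℂ (e i) v) with hs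
    have hsc : conj s = conj w * (inner ℂ (e j) v * inner ℂ v (e i)) := by
      rw [hs, map_mul, map_mul, inner_conj_symm, inner_conj_symm]
    -- The diagonal terms cancel because the eigenvalues are imaginary; only the interference of
    -- `eᵢ` and `eⱼ` in the state of `v` remains.
    have h3 : Complex.I * ((l i - l j) * (conj s - s)) = 0 := by
      rw [hsc, hs]
      linear_combination h2
    have hij' : l i = l j := by
      refine sub_eq_zero.1 ((mul_eq_zero.1 ((mul_eq_zero.1 h3).resolve_left
        Complex.I_ne_zero)).resolve_right fun h => hw ?_)
      exact Complex.conj_eq_iff_im.1 (sub_eq_zero.1 h)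
    rw [h1, hz]
    refine commutator_rankOne_eq_zero hc (l := l i) ?_
    rw [map_add, map_smul, hl, hl, hij', smul_add, smul_comm]
  refine eq_zero_of_quadratic_form_basis e single (fun i j hij => ?_) (fun i j hij => ?_)
  -- Multiplication by `i` turns imaginary parts into real parts up to sign: `w = 1` uses `him` and
  -- `w = i` uses `hre`.
  · have := pair i j 1 hij (by simpa using him j i hij.symm)
    simpa using this
  · exact pair i j Complex.I hij (by simpa using hre j i hij.symm)

end Operators

/-! ### Constant test maps, and the passage from points to `Ω` -/

section Constants

variable {Ω H : Type*} [NormedAddCommGroup H] [InnerProductSpace ℂ H] [CompleteSpace H]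

/-- The weights `2⁻ⁿ (1 + i / (n + 1))`. -/
noncomputable def genericWeight (n : ℕ) : ℂ := (1 / 2 : ℂ) ^ n * (1 + Complex.I / (n + 1))

theorem summable_norm_genericWeight : Summable fun n => ‖genericWeight n‖ := by
  refine Summable.of_nonneg_of_le (fun n => norm_nonneg _) (fun n => ?_)
    (summable_geometric_two.mul_right 2)
  rw [genericWeight, norm_mul, norm_pow]
  gcongr
  · simp
  · refine (norm_add_le _ _).trans ?_
    rw [norm_one, norm_div, Complex.norm_I]
    have h : (1 : ℝ) ≤ ‖(n + 1 : ℂ)‖ := by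
      have : (n + 1 : ℂ) = ((n + 1 : ℕ) : ℂ) := by push_cast; rfl
      rw [this, Complex.norm_natCast]
      exact_mod_cast Nat.succ_pos n
    have := div_le_one_of_le₀ h (norm_nonneg _)
    linarith

/-- The factors `1 + i/(n + 1)` have distinct arguments in `(0, π/4]`, so for different indices the
product is neither real nor imaginary; the powers of `1/2` only ensure summability. -/
theorem conj_genericWeight_mul (i j : ℕ) :
    conj (genericWeight i) * genericWeight j =
      (((1 / 2 : ℝ) ^ i * (1 / 2) ^ j * (1 + 1 / ((i + 1) * (j + 1))) : ℝ) : ℂ) +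
      (((1 / 2 : ℝ) ^ i * (1 / 2) ^ j * (1 / (j + 1) - 1 / (i + 1)) : ℝ) : ℂ) * Complex.I := by
  simp only [genericWeight, map_mul, map_pow, map_add, map_div₀, map_one, Complex.conj_I,
    map_natCast, map_ofNat]
  have hi : (i + 1 : ℂ) ≠ 0 := Nat.cast_add_one_ne_zero i
  have hj : (j + 1 : ℂ) ≠ 0 := Nat.cast_add_one_ne_zero j
  push_cast
  field_simp
  linear_combination (-1 : ℂ) * Complex.I_sq

theorem conj_genericWeight_mul_re_ne_zero (i j : ℕ) :
    (conj (genericWeight i) * genericWeight j).re ≠ 0 := by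
  rw [conj_genericWeight_mul]
  simp only [Complex.add_re, Complex.ofReal_re, Complex.re_ofReal_mul, Complex.I_re, mul_zero,
    add_zero]
  positivity

theorem conj_genericWeight_mul_im_ne_zero {i j : ℕ} (hij : i ≠ j) :
    (conj (genericWeight i) * genericWeight j).im ≠ 0 := by
  rw [conj_genericWeight_mul]
  simp only [Complex.add_im, Complex.ofReal_im, Complex.im_ofReal_mul,
    Complex.I_im, mul_one, zero_add]
  refine mul_ne_zero (by positivity) (sub_ne_zero.2 fun h => hij ?_)
  have h1 : (j + 1 : ℝ) = i + 1 := by simpa using h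
  exact_mod_cast (add_right_cancel h1).symm

variable (C : StarSubalgebra ℂ (H →L[ℂ] H)) {e : HilbertBasis ℕ ℂ H}

/-- With `T = |u⟩⟨e₀|`, one has `T T* = |u⟩⟨u|`. Unlike `|u⟩⟨u|`, the operator `T` is linear in `u`,
so sums and series can be treated termwise. -/
theorem rankOne_self_mem {u : H} (h : rankOne ℂ u (e 0) ∈ C) : rankOne ℂ u u ∈ C := by
  have h1 := mul_mem h (star_mem h)
  rw [ContinuousLinearMap.star_eq_adjoint, adjoint_rankOne, ContinuousLinearMap.mul_def,
    rankOne_comp_rankOne, inner_self_eq_norm_sq_to_K, e.orthonormal.1] at h1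
  simpa using h1

theorem rankOne_mem_of_mem_span (he : ∀ i j, rankOne ℂ (e i) (e j) ∈ C) {u : H}
    (hu : u ∈ Submodule.span ℂ (Set.range e)) : rankOne ℂ u u ∈ C := by
  apply rankOne_self_mem C (e := e)
  induction hu using Submodule.span_induction with
  | mem x hx => obtain ⟨i, rfl⟩ := hx; exact he i 0
  | zero => simp
  | add x y _ _ hx hy => rw [map_add]; exact add_mem hx hy
  | smul a x _ hx => rw [map_smul]; exact C.smul_mem hx a

theorem summable_smul_rankOne {f : ℕ → ℂ} (hf : Summable fun n => ‖f n‖) (p q : ℕ → ℕ) :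
    Summable fun n => f n • rankOne ℂ (e (p n)) (e (q n)) := by
  refine Summable.of_norm (hf.congr fun n => ?_)
  rw [norm_smul, norm_rankOne, e.orthonormal.1, e.orthonormal.1, mul_one, mul_one]

/-- A star subalgebra of operators that contains the norm-convergent series of matrix units
contains a generic rank-one operator. -/
theorem exists_generic_rankOne_mem
    (hsum : ∀ f : ℕ → ℂ, (Summable fun n => ‖f n‖) → ∀ p q : ℕ → ℕ,
      ∑' n, f n • rankOne ℂ (e (p n)) (e (q n)) ∈ C) :
    ∃ v : H, rankOne ℂ v v ∈ C ∧ (∀ i, inner ℂ (e i) v = genericWeight i) := by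
  have hs : Summable fun n => genericWeight n • e n := by
    refine Summable.of_norm (summable_norm_genericWeight.congr fun n => ?_)
    rw [norm_smul, e.orthonormal.1, mul_one]
  refine ⟨∑' n, genericWeight n • e n, rankOne_self_mem C (e := e) ?_, fun i => ?_⟩
  · have h : (rankOne ℂ (∑' n, genericWeight n • e n) (e 0) : H →L[ℂ] H) =
        ∑' n, genericWeight n • rankOne ℂ (e n) (e 0) := by
      ext x
      have h1 := ((summable_smul_rankOne (e := e) summable_norm_genericWeight id
        fun _ => 0).hasSum.mapL (ContinuousLinearMap.apply ℂ H x)).tsum_eq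
      have h2 := (hs.hasSum.const_smul (inner ℂ (e 0) x)).tsum_eq
      simp only [ContinuousLinearMap.apply_apply, smul_apply, rankOne_apply, id] at h1
      rw [rankOne_apply, ← h1, ← h2]
      exact tsum_congr fun n => smul_comm _ _ _
    rw [h]
    exact hsum _ summable_norm_genericWeight id fun _ => 0
  · have h := (hs.hasSum.mapL (innerSL ℂ (e i))).tsum_eq
    simp only [innerSL_apply_apply, inner_smul_right] at h
    rw [← h, tsum_eq_single i]
    · rw [inner_self_eq_norm_sq_to_K, e.orthonormal.1]; simp
    · intro n hn
      rw [e.orthonormal.2 hn.symm, mul_zero]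

theorem exists_diagonal_mem
    (hsum : ∀ f : ℕ → ℂ, (Summable fun n => ‖f n‖) → ∀ p q : ℕ → ℕ,
      ∑' n, f n • rankOne ℂ (e (p n)) (e (q n)) ∈ C) :
    ∃ D ∈ C, star D = D ∧ ∀ n, D (e n) = (((1 / 2 : ℝ) ^ n : ℝ) : ℂ) • e n := by
  have hf : Summable fun n : ℕ => ‖(((1 / 2 : ℝ) ^ n : ℝ) : ℂ)‖ := by
    refine summable_geometric_two.congr fun n => ?_
    rw [Complex.norm_real, Real.norm_of_nonneg (by positivity)]
  have hs := summable_smul_rankOne (e := e) hf id id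
  refine ⟨_, hsum _ hf id id, ?_, fun k => ?_⟩
  · rw [tsum_star]
    refine tsum_congr fun n => ?_
    rw [star_smul, ContinuousLinearMap.star_eq_adjoint, adjoint_rankOne, Complex.star_def,
      Complex.conj_ofReal]
  · have h := (hs.hasSum.mapL (ContinuousLinearMap.apply ℂ H (e k))).tsum_eq
    simp only [ContinuousLinearMap.apply_apply] at h
    rw [← h, tsum_eq_single k]
    · simp [e.orthonormal.1]
    · intro n hn
      simp [e.orthonormal.2 hn]

/-- A 2-local spatial map is implemented by one element, if its domain contains enough constant
maps. -/
theorem exists_isImplementedBy {S : Type*} [SetLike S (SkewMaps Ω H)] (K : S) {Δ : K → K}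
    (hΔ : IsTwoLocalSpatial K Δ) (he : ∀ i j, rankOne ℂ (e i) (e j) ∈ C)
    (hsum : ∀ f : ℕ → ℂ, (Summable fun n => ‖f n‖) → ∀ p q : ℕ → ℕ,
      ∑' n, f n • rankOne ℂ (e (p n)) (e (q n)) ∈ C)
    (hC : ∀ T ∈ C, star T = -T → ∃ x : K, ∀ t, ((x : SkewMaps Ω H) : OpMaps Ω H) t = T) :
    ∃ a : SkewMaps Ω H, IsImplementedBy K Δ a := by
  have hI : ∀ T ∈ C, star T = T →
      ∃ x : K, ∀ t, ((x : SkewMaps Ω H) : OpMaps Ω H) t = Complex.I • T := by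
    intro T hT hs
    refine hC _ (C.smul_mem hT _) ?_
    rw [star_smul, hs, Complex.star_def, Complex.conj_I, neg_smul]
  have hstar : ∀ u : H, star (rankOne ℂ u u : H →L[ℂ] H) = rankOne ℂ u u := fun u => by
    rw [ContinuousLinearMap.star_eq_adjoint, adjoint_rankOne]
  obtain ⟨D, hDC, hDs, hDe⟩ := exists_diagonal_mem C hsum
  obtain ⟨v, hvC, hv⟩ := exists_generic_rankOne_mem C hsum
  obtain ⟨x₀, hx₀⟩ := hI D hDC hDs
  obtain ⟨y₀, hy₀⟩ := hI _ hvC (hstar v)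
  -- Since `x₀` and `y₀` are constant, this one `a`, chosen before `t`, serves all points.
  obtain ⟨a, ha₁, ha₂⟩ := hΔ x₀ y₀
  have hv' : ∀ i, inner ℂ v (e i) = conj (genericWeight i) := fun i => by
    rw [← hv, inner_conj_symm]
  have bracket : ∀ (b x : SkewMaps Ω H) (t : Ω), ((⁅b, x⁆ : SkewMaps Ω H) : OpMaps Ω H) t =
      (b : OpMaps Ω H) t * (x : OpMaps Ω H) t - (x : OpMaps Ω H) t * (b : OpMaps Ω H) t :=
    fun _ _ _ => rfl
  have skew : ∀ (b : SkewMaps Ω H) (t : Ω), star ((b : OpMaps Ω H) t) = -(b : OpMaps Ω H) t :=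
    fun b t => congrFun b.2 t
  refine ⟨a, fun x => Subtype.ext (funext fun t => ?_)⟩
  let ev : K → H →L[ℂ] H := fun x => ((x : SkewMaps Ω H) : OpMaps Ω H) t
  let δ : K → H →L[ℂ] H := fun x =>
    ((Δ x : SkewMaps Ω H) : OpMaps Ω H) t -
      ((⁅a, (x : SkewMaps Ω H)⁆ : SkewMaps Ω H) : OpMaps Ω H) t
  have key : δ x = 0 := by
    refine eq_zero_of_twoLocal_commutator e ev δ ?_ (x₀ := x₀) (y₀ := y₀)
      (by simp only [δ, ha₁, sub_self]) (by simp only [δ, ha₂, sub_self]) (skew _ t)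
      (m := fun n => (1 / 2 : ℝ) ^ n) ?_ ?_ (hy₀ t) ?_ ?_ ?_ x
    · intro x y
      obtain ⟨b, hb₁, hb₂⟩ := hΔ x y
      refine ⟨(b : OpMaps Ω H) t - (a : OpMaps Ω H) t, ?_, ?_, ?_⟩
      · rw [star_sub, skew, skew]; abel
      · simp only [δ, ev, hb₁, bracket]; noncomm_ring
      · simp only [δ, ev, hb₂, bracket]; noncomm_ring
    · exact pow_right_injective₀ (by norm_num) (by norm_num)
    · intro n
      rw [show ev x₀ = _ from hx₀ t, smul_apply, hDe, smul_smul]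
    · intro i j _
      rw [hv, hv']
      exact conj_genericWeight_mul_re_ne_zero i j
    · intro i j hij
      rw [hv, hv']
      exact conj_genericWeight_mul_im_ne_zero hij
    · intro u hu
      obtain ⟨z, hz⟩ := hI _ (rankOne_mem_of_mem_span C he hu) (hstar u)
      exact ⟨z, hz t⟩
  exact sub_eq_zero.1 key

end Constants

/-! ### From implementation to Lie derivation -/

section Derivation

/-- A self-map of a Lie subalgebra that is implemented by an element of the ambient Lie algebra
is a spatial derivation. -/
theorem IsImplementedBy.isSpatialDerivation {A : Type*} [LieRing A] [LieAlgebra ℝ A]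
    {K : LieSubalgebra ℝ A} {Δ : K → K} {a : A} (h : IsImplementedBy K Δ a) :
    IsSpatialDerivation K Δ := by
  refine ⟨⟨{ toFun := Δ, map_add' := fun x y => ?_, map_smul' := fun r x => ?_ },
    fun x y => ?_⟩, fun _ => rfl, a, h⟩
  · apply Subtype.ext
    change ((Δ (x + y) : K) : A) = (Δ x : A) + (Δ y : A)
    rw [h, h, h, ← lie_add]
    rfl
  · apply Subtype.ext
    change ((Δ (r • x) : K) : A) = r • (Δ x : A)
    rw [h, h, ← lie_smul]
    rfl
  · apply Subtype.ext
    change ((Δ ⁅x, y⁆ : K) : A) = ⁅(x : A), (Δ y : A)⁆ - ⁅(y : A), (Δ x : A)⁆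
    rw [h, h, h, LieSubalgebra.coe_bracket, leibniz_lie, ← lie_skew (y : A), sub_neg_eq_add,
      add_comm]

end Derivation

/-! ### The two function algebras -/

section VonNeumann

variable {Ω H : Type*} [NormedAddCommGroup H] [InnerProductSpace ℂ H] [CompleteSpace H]

/-- The embedding of the operators as constant maps. -/
def constOpMaps : (H →L[ℂ] H) →⋆ₐ[ℂ] OpMaps Ω H where
  toFun T := fun _ => T
  map_one' := rfl
  map_mul' _ _ := rfl
  map_zero' := rfl
  map_add' _ _ := rfl
  commutes' _ := rfl
  map_star' _ := rfl

/-- Evaluation at a point, as a homomorphism on a `*`-subalgebra of operator-valued maps. -/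
def evalOpMaps (N : StarSubalgebra ℂ (OpMaps Ω H)) (t : Ω) : N →⋆ₐ[ℂ] (H →L[ℂ] H) where
  toFun x := (x : OpMaps Ω H) t
  map_one' := rfl
  map_mul' _ _ := rfl
  map_zero' := rfl
  map_add' _ _ := rfl
  commutes' _ := rfl
  map_star' _ := rfl

/-- The series is summed in the abstract C⋆-algebra `M` and pulled back. Evaluation at `t` is a
`*`-homomorphism of C⋆-algebras, hence contractive, so the pulled-back sum is the expected operator
at every point. -/
theorem tsum_const_rankOne_mem {e : HilbertBasis ℕ ℂ H} (N : StarSubalgebra ℂ (OpMaps Ω H))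
    (hN : IsVonNeumannAlgebra N) (hunit : ∀ i j, matrixUnit Ω e i j ∈ N)
    {f : ℕ → ℂ} (hf : Summable fun n => ‖f n‖) (p q : ℕ → ℕ) :
    constOpMaps (∑' n, f n • rankOne ℂ (e (p n)) (e (q n))) ∈ N := by
  obtain ⟨M, _, _, ⟨φ⟩⟩ := hN
  let E : ℕ → ℕ → N := fun i j => ⟨matrixUnit Ω e i j, hunit i j⟩
  have hmul : ∀ i j, star (E i j) * E i j = E j j := by
    intro i j
    refine Subtype.ext (funext fun t => ?_)
    change star (rankOne ℂ (e i) (e j) : H →L[ℂ] H) * rankOne ℂ (e i) (e j) =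
      rankOne ℂ (e j) (e j)
    rw [ContinuousLinearMap.star_eq_adjoint, adjoint_rankOne, ContinuousLinearMap.mul_def,
      rankOne_comp_rankOne, inner_self_eq_norm_sq_to_K, e.orthonormal.1]
    simp
  have hstar : ∀ j, star (E j j) = E j j := by
    intro j
    refine Subtype.ext (funext fun t => ?_)
    change star (rankOne ℂ (e j) (e j) : H →L[ℂ] H) = rankOne ℂ (e j) (e j)
    rw [ContinuousLinearMap.star_eq_adjoint, adjoint_rankOne]
  have hproj : ∀ j, ‖φ (E j j)‖ ≤ 1 := by
    intro j
    apply IsStarProjection.norm_le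
    refine ⟨?_, ?_⟩
    · have := hmul j j
      rw [hstar] at this
      rw [IsIdempotentElem, ← map_mul, this]
    · rw [IsSelfAdjoint, ← map_star, hstar]
  have hnorm : ∀ i j, ‖φ (E i j)‖ ≤ 1 := by
    intro i j
    have h := CStarRing.norm_star_mul_self (x := φ (E i j))
    rw [← map_star, ← map_mul, hmul] at h
    -- The C⋆-identity gives `‖φ (E i j)‖² = ‖φ (E j j)‖ ≤ 1`.
    nlinarith [hproj j, norm_nonneg (φ (E i j))]
  have hs : Summable fun n => f n • φ (E (p n) (q n)) := by
    refine Summable.of_norm_bounded hf fun n => ?_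
    rw [norm_smul]
    exact mul_le_of_le_one_right (norm_nonneg _) (hnorm _ _)
  have hmem := (φ.symm (∑' n, f n • φ (E (p n) (q n)))).2
  convert hmem using 1
  funext t
  let ψ : M →⋆ₐ[ℂ] (H →L[ℂ] H) := (evalOpMaps N t).comp (φ.symm : M →⋆ₐ[ℂ] N)
  have hψ : Continuous ψ := by
    refine AddMonoidHomClass.continuous_of_bound ψ 1 fun x => ?_
    rw [one_mul]
    exact NonUnitalStarAlgHom.norm_apply_le ψ x
  have h := (hs.hasSum.map ψ hψ).tsum_eq
  refine Eq.trans ?_ h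
  refine tsum_congr fun n => ?_
  change _ = ((φ.symm (f n • φ (E (p n) (q n))) : N) : OpMaps Ω H) t
  rw [← map_smul φ, StarAlgEquiv.symm_apply_apply]
  rfl

theorem isSpatialDerivation_of_isVonNeumannAlgebra (e : HilbertBasis ℕ ℂ H)
    (N : StarSubalgebra ℂ (OpMaps Ω H)) (hN : IsVonNeumannAlgebra N)
    (hunit : ∀ i j, matrixUnit Ω e i j ∈ N) {Δ : skewPart N → skewPart N}
    (hΔ : IsTwoLocalSpatial (skewPart N) Δ) : IsSpatialDerivation (skewPart N) Δ := by
  obtain ⟨a, ha⟩ := exists_isImplementedBy (N.comap (constOpMaps (Ω := Ω) (H := H))) (e := e)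
    (skewPart N) hΔ hunit
    (fun f hf p q => tsum_const_rankOne_mem N hN hunit hf p q)
    (fun T hT hs => ⟨⟨⟨constOpMaps T, funext fun _ => hs⟩, hT⟩, fun _ => rfl⟩)
  exact ha.isSpatialDerivation

theorem exists_isImplementedBy_continuousModelSkew [TopologicalSpace Ω] (e : HilbertBasis ℕ ℂ H)
    {Δ : continuousModelSkew (Ω := Ω) e → continuousModelSkew (Ω := Ω) e}
    (hΔ : IsTwoLocalSpatial (continuousModelSkew (Ω := Ω) e) Δ) :
    ∃ a : SkewMaps Ω H, IsImplementedBy (continuousModelSkew (Ω := Ω) e) Δ a :=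
  exists_isImplementedBy ⊤ (e := e) _ hΔ (fun _ _ => trivial) (fun _ _ _ _ => trivial)
    fun T _ hs => ⟨⟨⟨fun _ => T, funext fun _ => hs⟩,
      ⟨‖T‖, fun _ => le_rfl⟩, fun i j => continuous_const (y := inner ℂ (e i) (T (e j)))⟩,
      fun _ => rfl⟩

end VonNeumann

end SpatialDerivations

theorem mainTheorem7 {Ω : Type*} [TopologicalSpace Ω]
    (_hΩ : SpatialDerivations.IsHyperstonean Ω)
    {H : Type*} [NormedAddCommGroup H] [InnerProductSpace ℂ H] [CompleteSpace H]
    (e : HilbertBasis ℕ ℂ H) :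
    (∀ N : StarSubalgebra ℂ (SpatialDerivations.OpMaps Ω H),
      SpatialDerivations.IsVonNeumannAlgebra N →
      SpatialDerivations.IsTypeI N →
      Nonempty (NonUnitalStarSubalgebra.center ℂ N ≃⋆ₐ[ℂ] C(Ω, ℂ)) →
      (∀ i j : ℕ, SpatialDerivations.matrixUnit Ω e i j ∈ N) →
      ∀ Δ : SpatialDerivations.skewPart N → SpatialDerivations.skewPart N,
        SpatialDerivations.IsTwoLocalSpatial (SpatialDerivations.skewPart N) Δ →
        SpatialDerivations.IsSpatialDerivation (SpatialDerivations.skewPart N) Δ) ∧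
    (∀ Δ : SpatialDerivations.continuousModelSkew (Ω := Ω) e →
        SpatialDerivations.continuousModelSkew (Ω := Ω) e,
      SpatialDerivations.IsTwoLocalSpatial
        (SpatialDerivations.continuousModelSkew (Ω := Ω) e) Δ →
      ∃ a : SpatialDerivations.SkewMaps Ω H,
        SpatialDerivations.IsImplementedBy
          (SpatialDerivations.continuousModelSkew (Ω := Ω) e) Δ a) := by
  exact ⟨fun N hN _ _ hunit _ hΔ =>
      SpatialDerivations.isSpatialDerivation_of_isVonNeumannAlgebra e N hN hunit hΔ,
    fun _ hΔ => SpatialDerivations.exists_isImplementedBy_continuousModelSkew e hΔ⟩
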